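/- Let $(\Omega,\mathcal A)$ be a measurable space, $\mathcal C\subset\mathcal A$ a sub-$\sigma$-algebra and $\mu_1,\dots,\mu_n$ finite (positive) measures on $(\Omega,\mathcal A)$. Assume that for every $i=1,\dots,n$ the $\sigma$-algebra $\mathcal C$ is $\mu_i$-coarser than $\mathcal A$, that is: for every $E\in\mathcal A$ with $\mu_i(E)>0$ there is $E_0\in\mathcal A$, $E_0\subset E$, such that $\mu_i\big((C\cap E)\,\Delta\,E_0\big)>0$ for every $C\in\mathcal C$. Let $f_i\in L^1(\Omega,\mathcal A,\mu_i)$ for $i=1,\dots,n$, and let $F_{\mathcal C}:\mathcal A\to\prod_{i=1}^n L^1(\Omega,\mathcal C,\mu_i)$ be the countably additive vector measure $$F_{\mathcal C}(E)=\big(\mathbb E^{\mu_1}(f_1\chi_E\mid\mathcal C),\dots,\mathbb E^{\mu_n}(f_n\chi_E\mid\mathcal C)\big),$$ where $\mathbb E^{\mu_i}(\cdot\mid\mathcal C)$ denotes the conditional expectation with respect to $\mathcal C$ under $\mu_i$. Then $F_{\mathcal C}$ is Lyapunov: for every $E\in\mathcal A$ the set $\{F_{\mathcal C}(A\cap E):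 A\in\mathcal A\}$ is convex and weakly compact in $\prod_{i=1}^n L^1(\Omega,\mathcal C,\mu_i)$. -/

import Mathlib

open MeasureTheory

/-- A sub-σ-algebra `𝒞` is `μ`-coarser than `𝒜`: every `E ∈ 𝒜` with `μ E > 0` has a subset
`E₀ ∈ 𝒜` such that `μ (F ∆ E₀) > 0` for every `F = C ∩ E` in the trace of `𝒞` on `E`. -/
def IsCoarser {Ω : Type*} (𝒞 𝒜 : MeasurableSpace Ω) (μ : Measure[𝒜] Ω) : Prop :=
  ∀ E : Set Ω, MeasurableSet[𝒜] E → 0 < μ E →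
    ∃ E₀ : Set Ω, MeasurableSet[𝒜] E₀ ∧ E₀ ⊆ E ∧
      ∀ C : Set Ω, MeasurableSet[𝒞] C → 0 < μ (symmDiff (C ∩ E) E₀)

/-- A (countably additive) vector measure `G` on `(Ω, 𝒜)` is Lyapunov: for every `E ∈ 𝒜`, the set
`{G (A ∩ E) : A ∈ 𝒜}` is convex and compact for the weak topology of `X`. -/
def IsLyapunov {Ω X : Type*} [NormedAddCommGroup X] [NormedSpace ℝ X]
    {𝒜 : MeasurableSpace Ω} (G : VectorMeasure Ω X) : Prop :=
  ∀ E : Set Ω, MeasurableSet[𝒜] E →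
    Convex ℝ {x : X | ∃ A : Set Ω, MeasurableSet[𝒜] A ∧ G (A ∩ E) = x} ∧
    IsCompact (toWeakSpace ℝ X '' {x : X | ∃ A : Set Ω, MeasurableSet[𝒜] A ∧ G (A ∩ E) = x})

section CondExp

variable {Ω : Type*} {𝒞 𝒜 : MeasurableSpace Ω}

/-- The Banach space `L¹(Ω, 𝒞, μ)` for a sub-σ-algebra `𝒞` of `𝒜`, where `μ` stands for its
restriction to `𝒞`. -/
def L1Sub (hm : 𝒞 ≤ 𝒜) (μ : Measure[𝒜] Ω) : Type _ := Lp ℝ 1 (μ.trim hm)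

noncomputable instance (hm : 𝒞 ≤ 𝒜) (μ : Measure[𝒜] Ω) : NormedAddCommGroup (L1Sub hm μ) :=
  inferInstanceAs (NormedAddCommGroup (Lp ℝ 1 (μ.trim hm)))

noncomputable instance (hm : 𝒞 ≤ 𝒜) (μ : Measure[𝒜] Ω) : NormedSpace ℝ (L1Sub hm μ) :=
  inferInstanceAs (NormedSpace ℝ (Lp ℝ 1 (μ.trim hm)))

instance (hm : 𝒞 ≤ 𝒜) (μ : Measure[𝒜] Ω) : CompleteSpace (L1Sub hm μ) :=
  inferInstanceAs (CompleteSpace (Lp ℝ 1 (μ.trim hm)))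

/-- The conditional expectation of `g` given `𝒞` under `μ`, as an element of `L¹(Ω, 𝒞, μ)`. -/
noncomputable def condExpTrim (hm : 𝒞 ≤ 𝒜) (μ : Measure[𝒜] Ω) (g : Ω → ℝ) :
    L1Sub hm μ :=
  ((integrable_condExp (μ := μ) (m := 𝒞) (f := g)).trim hm
    stronglyMeasurable_condExp).toL1 (condExp 𝒞 μ g)

theorem condExpTrim_add (hm : 𝒞 ≤ 𝒜) (μ : Measure[𝒜] Ω) {g h : Ω → ℝ}
    (hg : Integrable g μ) (hh : Integrable h μ) :
    condExpTrim hm μ (g + h) = condExpTrim hm μ g + condExpTrim hm μ h := by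
  refine Eq.trans ((Integrable.toL1_eq_toL1_iff _ _ _ _).2 ?_) (Integrable.toL1_add _ _ _ _)
  exact StronglyMeasurable.ae_eq_trim_of_stronglyMeasurable hm stronglyMeasurable_condExp
    (stronglyMeasurable_condExp.add stronglyMeasurable_condExp) (condExp_add hg hh 𝒞)

theorem norm_condExpTrim_le (hm : 𝒞 ≤ 𝒜) (μ : Measure[𝒜] Ω) (g : Ω → ℝ) :
    ‖condExpTrim hm μ g‖ ≤ ∫ ω, |g ω| ∂μ := by
  refine (L1.norm_of_fun_eq_integral_norm _).trans_le ?_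
  rw [← integral_trim hm stronglyMeasurable_condExp.norm]
  exact integral_abs_condExp_le g

theorem hasSum_condExpTrim (hm : 𝒞 ≤ 𝒜) (μ : Measure[𝒜] Ω) {f : Ω → ℝ} (hf : Integrable f μ)
    {A : ℕ → Set Ω} (hA : ∀ k, MeasurableSet[𝒜] (A k))
    (hd : Pairwise (Function.onFun Disjoint A)) :
    HasSum (fun k => condExpTrim hm μ ((A k).indicator f))
      (condExpTrim hm μ ((⋃ k, A k).indicator f)) := by
  have hU : MeasurableSet[𝒜] (⋃ k, A k) := MeasurableSet.iUnion hA
  have key : ∀ s : Finset ℕ, condExpTrim hm μ ((⋃ k, A k).indicator f) =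
      ∑ k ∈ s, condExpTrim hm μ ((A k).indicator f) +
        condExpTrim hm μ (((⋃ k, A k) \ ⋃ k ∈ s, A k).indicator f) := by
    intro s
    induction s using Finset.induction_on with
    | empty => simp
    | insert a s ha ih =>
      rw [ih, Finset.sum_insert ha, add_comm (condExpTrim hm μ ((A a).indicator f)), add_assoc,
        ← condExpTrim_add hm μ (hf.indicator (hA a))
          (hf.indicator (hU.diff (Finset.measurableSet_biUnion _ fun k _ => hA k)))]
      congr 2
      refine (?_ : _ = _).trans (Set.indicator_union_of_disjoint ?_ f)
      · congr 1
        ext ω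
        have hdis : ω ∈ A a → ∀ k ∈ s, ω ∉ A k := fun h1 k hk h2 =>
          Set.disjoint_left.1 (hd (fun h => ha (h ▸ hk) : a ≠ k)) h1 h2
        simp only [Set.mem_sdiff, Set.mem_iUnion, Set.mem_union, Finset.mem_insert]
        grind
      · rw [Set.disjoint_left]
        intro ω h1 h2
        exact h2.2 (by simp [h1])
  have hsum := hasSum_integral_iUnion hA hd (f := fun ω => |f ω|) hf.abs.integrableOn
  have hlim := (hsum.const_sub (∫ ω in ⋃ k, A k, |f ω| ∂μ))
  rw [sub_self] at hlim
  refine tendsto_iff_norm_sub_tendsto_zero.2 (squeeze_zero (fun _ => norm_nonneg _) ?_ hlim)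
  intro s
  have hs : MeasurableSet[𝒜] (⋃ k ∈ s, A k) := Finset.measurableSet_biUnion _ fun k _ => hA k
  rw [key s, sub_add_cancel_left, norm_neg]
  refine (norm_condExpTrim_le hm μ _).trans (le_of_eq ?_)
  have h1 : (fun ω => |((⋃ k, A k) \ ⋃ k ∈ s, A k).indicator f ω|) =
      ((⋃ k, A k) \ ⋃ k ∈ s, A k).indicator (fun ω => |f ω|) := by
    ext ω; by_cases h : ω ∈ (⋃ k, A k) \ ⋃ k ∈ s, A k <;> simp [h]
  rw [h1, integral_indicator (hU.diff hs), setIntegral_sdiff hs hf.abs.integrableOn,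
    integral_biUnion_finset s (fun k _ => hA k) (fun i _ j _ hij => hd hij)
      (fun k _ => hf.abs.integrableOn)]
  exact Set.iUnion₂_subset fun k _ => Set.subset_iUnion A k

open Classical in
/-- The vector measure `E ↦ (E^{μ₁}(f₁ χ_E | 𝒞), …, E^{μₙ}(fₙ χ_E | 𝒞))` on `(Ω, 𝒜)` with values
in `∏ i, L¹(Ω, 𝒞, μᵢ)` (by Mathlib's convention it vanishes outside `𝒜`). -/
noncomputable def condExpVectorMeasure {n : ℕ} (hm : 𝒞 ≤ 𝒜) (μ : Fin n → Measure[𝒜] Ω)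
    (f : (i : Fin n) → Lp ℝ 1 (μ i)) :
    @VectorMeasure Ω 𝒜 ((i : Fin n) → L1Sub hm (μ i)) _ _ where
  measureOf' E := if MeasurableSet[𝒜] E then
      fun i => condExpTrim hm (μ i) (E.indicator (f i)) else 0
  empty' := by
    ext1 i
    have := norm_condExpTrim_le hm (μ i) (fun _ => (0 : ℝ))
    simpa using this
  not_measurable' E hE := if_neg hE
  m_iUnion' A hA hd := by
    simp only [hA, MeasurableSet.iUnion hA, if_true]
    exact Pi.hasSum.2 fun i => hasSum_condExpTrim hm (μ i) (L1.integrable_coeFn (f i)) hA hd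

end CondExp

/-!
Put `ν = ∑ i, (1 + |f_i|) μ i`. This finite measure has the null sets of the family `μ`, so `𝒞` is
`ν`-coarser than `𝒜`, and `T h = (E^{μ i}(h f_i | 𝒞))_i` is a bounded operator on `L²(ν)` with
`T χ_B` the value of the vector measure at `B`. The order interval `K = {0 ≤ h ≤ χ_E}` in `L²(ν)`
is convex, closed and bounded, hence weakly compact, and so `T '' K` is convex and weakly compact.
What remains is that every value of `T` on `K` is attained at an indicator, as in Lindenstrauss's
proof of Lyapunov's theorem. By Krein–Milman, `K ∩ T⁻¹{x}` has an extreme point as soon as it is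
nonempty (`extremePoints_fiber_nonempty`), and such a point is an indicator
(`exists_indicator_of_mem_extremePoints`), because on every set of positive measure there lives a
nonzero bounded function in the kernel of `T` (`exists_annihilated`). Only this last fact uses
that `𝒞` is coarser than `𝒜`.
-/

/-! ### Functions annihilated by finitely many conditional expectations -/

/-- A smallest `𝒞`-measurable set `H` containing `S` up to a null set: every `C ∈ 𝒞` that meets
`H` in positive measure meets `S` in positive measure. It is the set where `E^ν(χ_S | 𝒞) > 0`. -/
theorem exists_measurable_hull {Ω : Type*} {𝒞 𝒜 : MeasurableSpace Ω} (hm : 𝒞 ≤ 𝒜)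
    (ν : Measure[𝒜] Ω) [IsFiniteMeasure ν] {S : Set Ω} (hS : MeasurableSet[𝒜] S) :
    ∃ H : Set Ω, MeasurableSet[𝒞] H ∧ ν (S \ H) = 0 ∧
      ∀ C : Set Ω, MeasurableSet[𝒞] C → ν (C ∩ S) = 0 → ν (C ∩ H) = 0 := by
  have hint : Integrable (S.indicator fun _ => (1 : ℝ)) ν := (integrable_const _).indicator hS
  have key : ∀ C : Set Ω, MeasurableSet[𝒞] C →
      ∫ ω in C, (ν[S.indicator fun _ => (1 : ℝ) | 𝒞]) ω ∂ν = ν.real (C ∩ S) := by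
    intro C hC
    rw [setIntegral_condExp hm hint hC, setIntegral_indicator hS]
    simp
  set g := ν[S.indicator fun _ => (1 : ℝ) | 𝒞] with hg
  have hgm : StronglyMeasurable[𝒞] g := stronglyMeasurable_condExp
  have hgi : Integrable g ν := integrable_condExp
  have hH : MeasurableSet[𝒞] {ω | 0 < g ω} :=
    hgm.measurable measurableSet_Ioi
  refine ⟨{ω | 0 < g ω}, hH, ?_, fun C hC h0 => ?_⟩
  · have h1 := key _ hH.compl
    have h2 : ∫ ω in {ω | 0 < g ω}ᶜ, g ω ∂ν ≤ 0 :=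
      setIntegral_nonpos (hm _ hH.compl) fun ω hω => not_lt.1 hω
    have h3 : ν.real ({ω | 0 < g ω}ᶜ ∩ S) = 0 := le_antisymm (h1 ▸ h2) measureReal_nonneg
    rw [Set.sdiff_eq, Set.inter_comm]
    exact (measureReal_eq_zero_iff).1 h3
  · have h1 := key _ (hC.inter hH)
    have h2 : ν.real (C ∩ {ω | 0 < g ω} ∩ S) = 0 :=
      (measureReal_eq_zero_iff).2 (measure_mono_null (by grind) h0)
    rw [h2] at h1
    have hmeas := hm _ (hC.inter hH)
    by_contra hne
    have := (setIntegral_pos_iff_support_of_nonneg_ae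
      ((ae_restrict_iff' hmeas).2 (ae_of_all _ fun ω hω => le_of_lt hω.2))
      hgi.integrableOn).2 ?_
    · exact this.ne' h1
    · have hsub : C ∩ {ω | 0 < g ω} ⊆ Function.support g := fun ω hω => ne_of_gt hω.2
      rw [Set.inter_eq_right.2 hsub]
      exact pos_iff_ne_zero.2 hne

/-- Coarseness makes the fibres over `𝒞` infinite-dimensional: every set `D` of positive measure
carries a nonzero bounded function `u` with `E^{μ i}(u f_i | 𝒞) = 0` for finitely many `i`. The
proof adds one index at a time. It produces solutions `u₁`, `u₂` for the old indices on disjoint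
parts of `D` that lie over a common part of `𝒞`, and combines them with `𝒞`-measurable
coefficients so as to cancel the new conditional expectation. -/
theorem exists_annihilated {Ω ι : Type*} {𝒞 𝒜 : MeasurableSpace Ω} (hm : 𝒞 ≤ 𝒜)
    {ν : Measure[𝒜] Ω} [IsFiniteMeasure ν] (hν : IsCoarser 𝒞 𝒜 ν) {μ : ι → Measure[𝒜] Ω}
    [∀ i, IsFiniteMeasure (μ i)] {f : ι → Ω → ℝ} (hf : ∀ i, Integrable (f i) (μ i))
    (s : Finset ι) {D : Set Ω} (hD : MeasurableSet[𝒜] D) (hD0 : ν D ≠ 0) :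
    ∃ u : Ω → ℝ, Measurable[𝒜] u ∧ (∀ ω, |u ω| ≤ 1) ∧ (∀ ω ∉ D, u ω = 0) ∧
      ν {ω | u ω ≠ 0} ≠ 0 ∧ ∀ i ∈ s, (μ i)[fun ω => u ω * f i ω | 𝒞] =ᵐ[μ i] 0 := by
  classical
  have hint : ∀ (u : Ω → ℝ), Measurable[𝒜] u → (∀ ω, |u ω| ≤ 1) → ∀ i,
      Integrable (fun ω => u ω * f i ω) (μ i) := fun u hu hu1 i =>
    (hf i).bdd_mul hu.aestronglyMeasurable (ae_of_all _ hu1)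
  induction s using Finset.induction_on generalizing D with
  | empty =>
    refine ⟨D.indicator fun _ => 1, measurable_const.indicator hD, fun ω => ?_, fun ω h => ?_, ?_,
      by simp⟩
    · by_cases h : ω ∈ D <;> simp [h]
    · simp [h]
    · simpa using hD0
  | insert i s hi ih =>
    -- `D₁` and the part of `D \ D₁` over the hull `H` of `D₁` lie over a common part of `𝒞`;
    -- the latter is not null, as otherwise `H ∩ D` would agree with `D₁`.
    obtain ⟨D₁, hD₁, hD₁D, hD₁C⟩ := hν D hD (pos_iff_ne_zero.2 hD0)
    obtain ⟨H, hH, hSH, hHC⟩ := exists_measurable_hull hm ν hD₁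
    have hD₂ : MeasurableSet[𝒜] ((D \ D₁) ∩ H) := (hD.diff hD₁).inter (hm _ hH)
    have hD₂0 : ν ((D \ D₁) ∩ H) ≠ 0 := by
      intro h0
      refine (hD₁C H hH).ne' (measure_mono_null ?_ (measure_union_null h0 hSH))
      intro ω
      simp only [Set.mem_symmDiff, Set.mem_union, Set.mem_inter_iff, Set.mem_sdiff]
      have := @hD₁D ω
      tauto
    obtain ⟨H₂, hH₂, hSH₂, hHC₂⟩ := exists_measurable_hull hm ν hD₂
    have hD₁H₂ : ν (D₁ ∩ H₂) ≠ 0 := by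
      intro h0
      have h1 := hHC H₂ hH₂ (by rwa [Set.inter_comm])
      refine hD₂0 (measure_mono_null ?_ (measure_union_null h1 hSH₂))
      intro ω; simp only [Set.mem_union, Set.mem_inter_iff, Set.mem_sdiff]; tauto
    obtain ⟨u₁, hu₁m, hu₁b, hu₁D, hu₁0, hu₁⟩ := ih (hD₁.inter (hm _ hH₂)) hD₁H₂
    have hS₁ : MeasurableSet[𝒜] {ω | u₁ ω ≠ 0} := hu₁m (measurableSet_singleton 0).compl
    -- Looking for `u₂` over the hull `H₁` of the support of `u₁` keeps the multiple of `u₁` in the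
    -- first case below from vanishing.
    obtain ⟨H₁, hH₁, hSH₁, hHC₁⟩ := exists_measurable_hull hm ν hS₁
    have hD₂H₁ : ν ((D \ D₁) ∩ H ∩ H₁) ≠ 0 := by
      intro h0
      have h1 := hHC₂ H₁ hH₁ (by rwa [Set.inter_comm])
      refine hu₁0 (measure_mono_null ?_ (measure_union_null h1 hSH₁))
      intro ω hω
      have : ω ∈ D₁ ∩ H₂ := by_contra fun h => hω (hu₁D ω h)
      simp only [Set.mem_union, Set.mem_inter_iff, Set.mem_sdiff] at this ⊢
      tauto
    obtain ⟨u₂, hu₂m, hu₂b, hu₂D, hu₂0, hu₂⟩ := ih (hD₂.inter (hm _ hH₁)) hD₂H₁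
    have hdisj : ∀ ω, u₂ ω ≠ 0 → u₁ ω = 0 := by
      intro ω h
      refine hu₁D ω fun h' => ?_
      have h2 : ω ∈ (D \ D₁) ∩ H ∩ H₁ := by_contra fun h' => h (hu₂D ω h')
      exact h2.1.1.2 h'.1
    have pull : ∀ (c u : Ω → ℝ), Measurable[𝒞] c → (∀ ω, |c ω| ≤ 1) → Measurable[𝒜] u →
        (∀ ω, |u ω| ≤ 1) → ∀ j, (μ j)[fun ω => c ω * (u ω * f j ω) | 𝒞] =ᵐ[μ j]
          fun ω => c ω * ((μ j)[fun ω => u ω * f j ω | 𝒞]) ω := fun c u hc hc1 hu hu1 j =>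
      condExp_stronglyMeasurable_mul_of_bound hm hc.stronglyMeasurable (hint u hu hu1 j) 1
        (ae_of_all _ hc1)
    set a₁ := (μ i)[fun ω => u₁ ω * f i ω | 𝒞] with ha₁
    set a₂ := (μ i)[fun ω => u₂ ω * f i ω | 𝒞] with ha₂
    have ha₁m : Measurable[𝒞] a₁ := stronglyMeasurable_condExp.measurable
    have ha₂m : Measurable[𝒞] a₂ := stronglyMeasurable_condExp.measurable
    by_cases hcase : ν ({ω | u₂ ω ≠ 0} ∩ {ω | a₁ ω ≠ 0}) = 0
    -- If `a₁` vanishes on the support of `u₂`, then `u₁` itself solves the problem over `{a₁ = 0}`.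
    · have hZ : MeasurableSet[𝒞] {ω | a₁ ω = 0} := ha₁m (measurableSet_singleton 0)
      set c : Ω → ℝ := {ω | a₁ ω = 0}.indicator fun _ => 1 with hc
      have hcm : Measurable[𝒞] c := measurable_const.indicator hZ
      have hcb : ∀ ω, |c ω| ≤ 1 := fun ω => by
        by_cases h : a₁ ω = 0 <;> simp [hc, h]
      refine ⟨fun ω => c ω * u₁ ω, (hcm.mono hm le_rfl).mul hu₁m, fun ω => ?_, fun ω h => ?_,
        fun h0 => ?_, ?_⟩
      · rw [abs_mul]; exact mul_le_one₀ (hcb ω) (abs_nonneg _) (hu₁b ω)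
      · beta_reduce
        rw [hu₁D ω fun h' => h (hD₁D h'.1), mul_zero]
      · have h1 := hHC₁ _ hZ (measure_mono_null ?_ h0)
        · refine hu₂0 (measure_mono_null ?_ (measure_union_null h1 hcase))
          intro ω h
          have h2 : ω ∈ (D \ D₁) ∩ H ∩ H₁ := by_contra fun h' => h (hu₂D ω h')
          by_cases h3 : a₁ ω = 0
          · exact Or.inl ⟨h3, h2.2⟩
          · exact Or.inr ⟨h, h3⟩
        · rintro ω ⟨h1, h2⟩
          have h1' : a₁ ω = 0 := h1
          simpa [hc, h1'] using h2
      · intro j hj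
        simp only [mul_assoc]
        refine (pull c u₁ hcm hcb hu₁m hu₁b j).trans ?_
        rcases Finset.mem_insert.1 hj with rfl | hj
        · refine ae_of_all _ fun ω => ?_
          by_cases h : a₁ ω = 0
          · simp [← ha₁, h]
          · simp [hc, h]
        · filter_upwards [hu₁ j hj] with ω hω
          simp [hω]
    -- Otherwise `a₂ u₁ - a₁ u₂` does, divided by a `𝒞`-measurable function to make it bounded by 1.
    · have hden : ∀ ω, 0 < 1 + |a₁ ω| + |a₂ ω| := fun ω => by positivity
      set d : Ω → ℝ := fun ω => 1 + |a₁ ω| + |a₂ ω| with hd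
      have hdm : Measurable[𝒞] d := 
        (measurable_const.add (continuous_abs.measurable.comp ha₁m)).add
          (continuous_abs.measurable.comp ha₂m)
      have hc₁m : Measurable[𝒞] fun ω => a₁ ω / d ω := ha₁m.div hdm
      have hc₂m : Measurable[𝒞] fun ω => a₂ ω / d ω := ha₂m.div hdm
      have hc₁b : ∀ ω, |a₁ ω / d ω| ≤ 1 := fun ω => by
        have h0 := hden ω
        simp only [hd] at h0 ⊢
        rw [abs_div, abs_of_pos h0, div_le_one h0]
        linarith [abs_nonneg (a₂ ω)]
      have hc₂b : ∀ ω, |a₂ ω / d ω| ≤ 1 := fun ω => by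
        have h0 := hden ω
        simp only [hd] at h0 ⊢
        rw [abs_div, abs_of_pos h0, div_le_one h0]
        linarith [abs_nonneg (a₁ ω)]
      refine ⟨fun ω => a₂ ω / d ω * u₁ ω - a₁ ω / d ω * u₂ ω,
        ((hc₂m.mono hm le_rfl).mul hu₁m).sub ((hc₁m.mono hm le_rfl).mul hu₂m),
        fun ω => ?_, fun ω h => ?_, fun h0 => hcase (measure_mono_null ?_ h0), ?_⟩
      · beta_reduce
        by_cases h : u₂ ω = 0
        · rw [h, mul_zero, sub_zero, abs_mul]
          exact mul_le_one₀ (hc₂b ω) (abs_nonneg _) (hu₁b ω)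
        · rw [hdisj ω h, mul_zero, zero_sub, abs_neg, abs_mul]
          exact mul_le_one₀ (hc₁b ω) (abs_nonneg _) (hu₂b ω)
      · beta_reduce
        rw [hu₁D ω fun h' => h (hD₁D h'.1), hu₂D ω fun h' => h h'.1.1.1]
        simp
      · rintro ω ⟨h1, h2⟩
        simp only [Set.mem_ofPred_eq] at h1 h2 ⊢
        rw [hdisj ω h1, mul_zero, zero_sub, neg_ne_zero]
        exact mul_ne_zero (div_ne_zero h2 (hden ω).ne') h1
      · intro j hj
        have hi₁ : Integrable (fun ω => a₂ ω / d ω * (u₁ ω * f j ω)) (μ j) :=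
          (hint u₁ hu₁m hu₁b j).bdd_mul (hc₂m.mono hm le_rfl).aestronglyMeasurable
            (ae_of_all _ hc₂b)
        have hi₂ : Integrable (fun ω => a₁ ω / d ω * (u₂ ω * f j ω)) (μ j) :=
          (hint u₂ hu₂m hu₂b j).bdd_mul (hc₁m.mono hm le_rfl).aestronglyMeasurable
            (ae_of_all _ hc₁b)
        simp only [sub_mul, mul_assoc]
        refine (condExp_sub hi₁ hi₂ 𝒞).trans ?_
        have p₁ := pull _ u₁ hc₂m hc₂b hu₁m hu₁b j
        have p₂ := pull _ u₂ hc₁m hc₁b hu₂m hu₂b j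
        rcases Finset.mem_insert.1 hj with rfl | hj
        · filter_upwards [p₁, p₂] with ω h1 h2
          rw [Pi.sub_apply, h1, h2, ← ha₁, ← ha₂, Pi.zero_apply]
          ring
        · filter_upwards [p₁, p₂, hu₁ j hj, hu₂ j hj] with ω h1 h2 h3 h4
          rw [Pi.sub_apply, h1, h2, h3, h4]
          simp

/-- Coarseness passes to a measure with the same null sets as the family: it then holds for all
the measures together. -/
theorem IsCoarser.of_forall_absolutelyContinuous {Ω ι : Type*} {𝒞 𝒜 : MeasurableSpace Ω}
    {μ : ι → Measure[𝒜] Ω} {ν : Measure[𝒜] Ω} (h : ∀ i, IsCoarser 𝒞 𝒜 (μ i))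
    (hμν : ∀ i, μ i ≪ ν) (hν : ∀ E : Set Ω, (∀ i, μ i E = 0) → ν E = 0) : IsCoarser 𝒞 𝒜 ν := by
  intro E hE hE0
  obtain ⟨i, hi⟩ : ∃ i, μ i E ≠ 0 := by
    by_contra! hall
    exact hE0.ne' (hν E hall)
  obtain ⟨E₀, hE₀, hsub, hC⟩ := h i E hE (pos_iff_ne_zero.2 hi)
  exact ⟨E₀, hE₀, hsub, fun C hC' =>
    pos_iff_ne_zero.2 fun h0 => (hC C hC').ne' (hμν i h0)⟩

/-! ### The operator of multiplication followed by conditional expectation -/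

section Operator

variable {Ω : Type*} {𝒞 𝒜 : MeasurableSpace Ω}

theorem condExpTrim_congr (hm : 𝒞 ≤ 𝒜) (μ : Measure[𝒜] Ω) {g h : Ω → ℝ} (hgh : g =ᵐ[μ] h) :
    condExpTrim hm μ g = condExpTrim hm μ h :=
  (Integrable.toL1_eq_toL1_iff _ _ _ _).2 <|
    StronglyMeasurable.ae_eq_trim_of_stronglyMeasurable hm stronglyMeasurable_condExp
      stronglyMeasurable_condExp (condExp_congr_ae hgh)

theorem condExpTrim_smul (hm : 𝒞 ≤ 𝒜) (μ : Measure[𝒜] Ω) (c : ℝ) (g : Ω → ℝ) :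
    condExpTrim hm μ (c • g) = c • condExpTrim hm μ g := by
  refine Eq.trans ((Integrable.toL1_eq_toL1_iff _ _ _ _).2 ?_) (Integrable.toL1_smul _ _ c)
  exact StronglyMeasurable.ae_eq_trim_of_stronglyMeasurable hm stronglyMeasurable_condExp
    (stronglyMeasurable_condExp.const_smul c) (condExp_smul c g 𝒞)

theorem condExpTrim_eq_zero (hm : 𝒞 ≤ 𝒜) (μ : Measure[𝒜] Ω) {g : Ω → ℝ}
    (hg : μ[g | 𝒞] =ᵐ[μ] 0) : condExpTrim hm μ g = 0 := by
  refine Eq.trans ((Integrable.toL1_eq_toL1_iff _ _ _ (integrable_zero _ _ _)).2 ?_)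
    (Integrable.toL1_zero _)
  exact StronglyMeasurable.ae_eq_trim_of_stronglyMeasurable hm stronglyMeasurable_condExp
    stronglyMeasurable_zero hg

variable {μ ν : Measure[𝒜] Ω} {f : Ω → ℝ}

theorem lintegral_enorm_mul_le_of_withDensity_le (hf : Integrable f μ)
    (hle : μ.withDensity (fun ω => ‖f ω‖ₑ) ≤ ν) (h : Lp ℝ 2 ν) :
    ∫⁻ ω, ‖h ω * f ω‖ₑ ∂μ ≤ eLpNorm h 1 ν := by
  rw [eLpNorm_one_eq_lintegral_enorm]
  refine le_trans (le_of_eq ?_) (lintegral_mono' hle le_rfl)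
  rw [lintegral_withDensity_eq_lintegral_mul₀ hf.aestronglyMeasurable.enorm
    (Lp.stronglyMeasurable h).measurable.enorm.aemeasurable]
  simp only [enorm_mul, Pi.mul_apply, mul_comm]

theorem eLpNorm_one_le_two [IsFiniteMeasure ν] (h : Lp ℝ 2 ν) :
    eLpNorm h 1 ν ≤ eLpNorm h 2 ν * ν Set.univ ^ (1 / 2 : ℝ) := by
  have := eLpNorm_le_eLpNorm_mul_rpow_measure_univ (p := 1) (q := 2) (μ := ν) (by norm_num)
    (Lp.aestronglyMeasurable h)
  convert this using 3
  norm_num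

theorem integrable_Lp_mul [IsFiniteMeasure ν] (hf : Integrable f μ)
    (hle : μ.withDensity (fun ω => ‖f ω‖ₑ) ≤ ν) (h : Lp ℝ 2 ν) :
    Integrable (fun ω => h ω * f ω) μ := by
  refine ⟨(Lp.stronglyMeasurable h).aestronglyMeasurable.mul hf.aestronglyMeasurable, ?_⟩
  refine (lintegral_enorm_mul_le_of_withDensity_le hf hle h).trans_lt ?_
  exact (eLpNorm_one_le_two h).trans_lt (ENNReal.mul_lt_top (Lp.eLpNorm_lt_top h)
    (ENNReal.rpow_lt_top_of_nonneg (by norm_num) (measure_ne_top _ _)))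

/-- The bounded operator `h ↦ E^μ(h f | 𝒞)` from `L²(ν)` to `L¹(Ω, 𝒞, μ)`. Since `f` is merely
integrable, `h f` need not be `μ`-integrable for `h ∈ L²(μ)`; the hypothesis `|f| μ ≤ ν` is what
makes the operator defined and bounded on `L²(ν)`, and `μ ≪ ν` makes it independent of
representatives. -/
noncomputable def condExpMulCLM (hm : 𝒞 ≤ 𝒜) [IsFiniteMeasure ν] (hf : Integrable f μ)
    (hμν : μ ≪ ν) (hle : μ.withDensity (fun ω => ‖f ω‖ₑ) ≤ ν) :
    Lp ℝ 2 ν →L[ℝ] L1Sub hm μ :=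
  LinearMap.mkContinuous
    { toFun := fun h => condExpTrim hm μ fun ω => h ω * f ω
      map_add' := fun g h => by
        rw [← condExpTrim_add hm μ (integrable_Lp_mul hf hle g)
          (integrable_Lp_mul hf hle h)]
        refine condExpTrim_congr hm μ ?_
        filter_upwards [hμν.ae_le (Lp.coeFn_add g h)] with ω hω
        simp only [hω, Pi.add_apply, add_mul]
      map_smul' := fun c g => by
        rw [RingHom.id_apply, ← condExpTrim_smul]
        refine condExpTrim_congr hm μ ?_
        filter_upwards [hμν.ae_le (Lp.coeFn_smul c g)] with ω hω
        simp only [hω, Pi.smul_apply, smul_eq_mul, mul_assoc] }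
    (ν Set.univ ^ (1 / 2 : ℝ)).toReal fun h => by
      refine (norm_condExpTrim_le hm μ _).trans ?_
      simp only [← Real.norm_eq_abs]
      rw [integral_norm_eq_lintegral_enorm
        (integrable_Lp_mul hf hle h).aestronglyMeasurable, mul_comm, Lp.norm_def,
        ← ENNReal.toReal_mul]
      exact ENNReal.toReal_mono (ENNReal.mul_ne_top (Lp.eLpNorm_ne_top h)
        (ENNReal.rpow_ne_top_of_nonneg (by norm_num) (measure_ne_top _ _)))
        ((lintegral_enorm_mul_le_of_withDensity_le hf hle h).trans (eLpNorm_one_le_two h))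

theorem condExpMulCLM_eq (hm : 𝒞 ≤ 𝒜) [IsFiniteMeasure ν] (hf : Integrable f μ)
    (hμν : μ ≪ ν) (hle : μ.withDensity (fun ω => ‖f ω‖ₑ) ≤ ν) {h : Lp ℝ 2 ν} {u : Ω → ℝ}
    (hu : h =ᵐ[ν] u) :
    condExpMulCLM hm hf hμν hle h = condExpTrim hm μ fun ω => u ω * f ω :=
  condExpTrim_congr hm μ (by
    filter_upwards [hμν.ae_le hu] with ω hω
    rw [hω])

end Operator

/-! ### Extreme points of fibres in a Hilbert space -/

/-- Weak compactness of bounded closed convex sets, by the Banach–Alaoglu theorem: the Riesz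
isomorphism carries the weak-* topology of the dual to the weak topology. -/
theorem isCompact_toWeakSpace_image {H : Type*} [NormedAddCommGroup H] [InnerProductSpace ℝ H]
    [CompleteSpace H] {K : Set H} (hK : Convex ℝ K) (hc : IsClosed K)
    (hb : Bornology.IsBounded K) : IsCompact (toWeakSpace ℝ H '' K) := by
  obtain ⟨r, hr⟩ := hb.subset_closedBall 0
  let Φ : WeakDual ℝ H → WeakSpace ℝ H := fun φ =>
    toWeakSpace ℝ H ((InnerProductSpace.toDual ℝ H).symm (WeakDual.toStrongDual φ))
  have hΦ : Continuous Φ := by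
    refine WeakBilin.continuous_of_continuous_eval _ fun ℓ => ?_
    obtain ⟨y, rfl⟩ := (InnerProductSpace.toDual ℝ H).surjective ℓ
    have : (fun φ : WeakDual ℝ H => φ y) = fun φ =>
        (InnerProductSpace.toDual ℝ H y)
          ((InnerProductSpace.toDual ℝ H).symm (WeakDual.toStrongDual φ)) := by
      ext φ
      rw [InnerProductSpace.toDual_apply_apply, real_inner_comm,
        InnerProductSpace.toDual_symm_apply]
      rfl
    have h2 : Continuous fun φ : WeakDual ℝ H => φ y := WeakDual.eval_continuous y
    rw [this] at h2
    exact h2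
  have hball := (WeakDual.isCompact_closedBall (𝕜 := ℝ) (E := H) 0 r).image hΦ
  refine hball.of_isClosed_subset ?_ ?_
  · have := hK.toWeakSpace_closure ℝ
    rw [hc.closure_eq] at this
    rw [this]
    exact isClosed_closure
  · rintro _ ⟨x, hx, rfl⟩
    refine ⟨StrongDual.toWeakDual (InnerProductSpace.toDual ℝ H x), ?_, ?_⟩
    · simpa using hr hx
    · simp [Φ]

/-- Krein–Milman for a fibre over `K` of a bounded operator; the norm topology does not suffice
since `K` need not be norm compact. -/
theorem extremePoints_fiber_nonempty {H X : Type*} [NormedAddCommGroup H] [InnerProductSpace ℝ H]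
    [CompleteSpace H] [NormedAddCommGroup X] [NormedSpace ℝ X] {K : Set H} (hK : Convex ℝ K)
    (hc : IsClosed K) (hb : Bornology.IsBounded K) (T : H →L[ℝ] X) {x : X} (hx : x ∈ T '' K) :
    ((K ∩ T ⁻¹' {x}).extremePoints ℝ).Nonempty := by
  have hcomp : IsCompact (toWeakSpace ℝ H '' (K ∩ T ⁻¹' {x})) :=
    isCompact_toWeakSpace_image
      (hK.inter ((convex_singleton x).is_linear_preimage T.toLinearMap.isLinear))
      (hc.inter (isClosed_singleton.preimage T.continuous)) (hb.subset Set.inter_subset_left)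
  obtain ⟨k, hk, rfl⟩ := hx
  have : LocallyConvexSpace ℝ (WeakSpace ℝ H) :=
    inferInstanceAs (LocallyConvexSpace ℝ (WeakBilin _))
  have h := hcomp.extremePoints_nonempty (Set.Nonempty.image _ ⟨k, hk, rfl⟩)
  rw [← image_extremePoints] at h
  exact h.of_image

/-! ### The order interval between `0` and an indicator in `L²` -/

section LpInterval

variable {Ω : Type*} [MeasurableSpace Ω] {ν : Measure Ω} [IsFiniteMeasure ν] {E : Set Ω}

theorem mem_Icc_indicatorConstLp (hE : MeasurableSet E) {h : Lp ℝ 2 ν} :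
    h ∈ Set.Icc 0 (indicatorConstLp 2 hE (measure_ne_top ν E) (1 : ℝ)) ↔
      ∀ᵐ ω ∂ν, 0 ≤ h ω ∧ h ω ≤ E.indicator 1 ω := by
  rw [Set.mem_Icc, ← Lp.coeFn_nonneg, ← Lp.coeFn_le, Filter.eventually_and]
  have h1 := indicatorConstLp_coeFn (p := 2) (hs := hE) (hμs := measure_ne_top ν E) (c := (1 : ℝ))
  refine and_congr Iff.rfl (Filter.eventually_congr ?_)
  filter_upwards [h1] with ω hω
  rw [hω]
  rfl

theorem isBounded_Icc_indicatorConstLp (hE : MeasurableSet E) :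
    Bornology.IsBounded
      (Set.Icc 0 (indicatorConstLp 2 hE (measure_ne_top ν E) (1 : ℝ))) := by
  refine (Metric.isBounded_closedBall (x := (0 : Lp ℝ 2 ν))
    (r := ‖indicatorConstLp 2 hE (measure_ne_top ν E) (1 : ℝ)‖)).subset fun h hh => ?_
  rw [mem_closedBall_zero_iff]
  refine norm_le_norm_of_abs_le_abs ?_
  rw [abs_of_nonneg hh.1, abs_of_nonneg (hh.1.trans hh.2)]
  exact hh.2

theorem convex_Icc_indicatorConstLp (hE : MeasurableSet E) :
    Convex ℝ (Set.Icc 0 (indicatorConstLp 2 hE (measure_ne_top ν E) (1 : ℝ))) := by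
  intro g hg h hh a b ha hb hab
  rw [mem_Icc_indicatorConstLp] at hg hh ⊢
  filter_upwards [hg, hh, Lp.coeFn_add (a • g) (b • h), Lp.coeFn_smul a g, Lp.coeFn_smul b h]
    with ω h1 h2 h3 h4 h5
  rw [h3, Pi.add_apply, h4, h5]
  exact convex_Icc (0 : ℝ) (E.indicator 1 ω) h1 h2 ha hb hab

end LpInterval

/-! ### Extreme points of the fibres are indicators -/

/-- If the kernel of `T` contains a nonzero bounded function on every set of positive measure, then
an extreme point `k` of `{0 ≤ h ≤ χ_E, T h = x}` is an indicator: otherwise `ε ≤ k ≤ 1 - ε` on some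
subset of `E` of positive measure, and `k` is the midpoint of `k ± ε u` for `u` in the kernel,
`|u| ≤ 1`, supported on that subset. -/
theorem exists_indicator_of_mem_extremePoints {Ω X : Type*} {𝒜 : MeasurableSpace Ω}
    {ν : Measure Ω} [IsFiniteMeasure ν] [NormedAddCommGroup X] [NormedSpace ℝ X]
    (T : Lp ℝ 2 ν →L[ℝ] X)
    (hT : ∀ D : Set Ω, MeasurableSet D → ν D ≠ 0 → ∃ u : Ω → ℝ, Measurable u ∧
      (∀ ω, |u ω| ≤ 1) ∧ (∀ ω ∉ D, u ω = 0) ∧ ν {ω | u ω ≠ 0} ≠ 0 ∧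
      ∀ U : Lp ℝ 2 ν, U =ᵐ[ν] u → T U = 0)
    {E : Set Ω} (hE : MeasurableSet E) {x : X} {k : Lp ℝ 2 ν}
    (hk : k ∈ (Set.Icc 0 (indicatorConstLp 2 hE (measure_ne_top ν E) (1 : ℝ)) ∩
      T ⁻¹' {x}).extremePoints ℝ) :
    ∃ A : Set Ω, MeasurableSet A ∧ k =ᵐ[ν] (A ∩ E).indicator 1 := by
  have hkm : Measurable k := (Lp.stronglyMeasurable k).measurable
  have hkE := (mem_Icc_indicatorConstLp hE).1 hk.1.1
  have hnull : ∀ m : ℕ,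
      ν {ω | ω ∈ E ∧ 1 / ((m : ℝ) + 1) ≤ k ω ∧ k ω ≤ 1 - 1 / ((m : ℝ) + 1)} = 0 := by
    intro m
    set ε : ℝ := 1 / ((m : ℝ) + 1) with hε
    have hε0 : 0 < ε := by positivity
    by_contra hD0
    obtain ⟨u, hum, hub, huD, hu0, huT⟩ := hT _
      (hE.inter (hkm measurableSet_Ici |>.inter (hkm measurableSet_Iic))) hD0
    have huL : MemLp u 2 ν := .of_bound hum.aestronglyMeasurable 1 (ae_of_all _ hub)
    set U : Lp ℝ 2 ν := huL.toLp u with hU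
    have hUu : U =ᵐ[ν] u := huL.coeFn_toLp
    have hmem : ∀ s : ℝ, |s| ≤ ε → k + s • U ∈
        Set.Icc 0 (indicatorConstLp 2 hE (measure_ne_top ν E) (1 : ℝ)) ∩ T ⁻¹' {x} := by
      intro s hs
      refine ⟨(mem_Icc_indicatorConstLp hE).2 ?_, ?_⟩
      · filter_upwards [hkE, hUu, Lp.coeFn_add k (s • U), Lp.coeFn_smul s U] with ω h1 h2 h3 h4
        rw [h3, Pi.add_apply, h4, Pi.smul_apply, h2, smul_eq_mul]
        by_cases hω : ω ∈ E ∧ ε ≤ k ω ∧ k ω ≤ 1 - ε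
        · have h5 : |s * u ω| ≤ ε := by
            rw [abs_mul]
            exact (mul_le_of_le_one_right (abs_nonneg s) (hub ω)).trans hs
          rw [Set.indicator_of_mem hω.1, Pi.one_apply]
          have := abs_le.1 h5
          constructor <;> linarith [hω.2.1, hω.2.2]
        · rw [huD ω hω, mul_zero, add_zero]
          exact h1
      · have := hk.1.2
        simp only [Set.mem_preimage, Set.mem_singleton_iff] at this ⊢
        rw [map_add, map_smul, huT U hUu, smul_zero, add_zero, this]
    have h := (mem_extremePoints.1 hk).2 _ (hmem ε (abs_of_pos hε0).le) _
      (hmem (-ε) (by rw [abs_neg, abs_of_pos hε0]))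
      ⟨1 / 2, 1 / 2, by norm_num, by norm_num, by norm_num, by module⟩
    have hU0 : U = 0 := by
      have : ε • U = 0 := by simpa using h.1
      exact (smul_eq_zero.1 this).resolve_left hε0.ne'
    refine hu0 ?_
    have : u =ᵐ[ν] 0 := hUu.symm.trans (hU0 ▸ Lp.coeFn_zero ℝ 2 ν)
    exact this
  have hA : MeasurableSet {ω | k ω = 1} := hkm (measurableSet_singleton 1)
  refine ⟨{ω | k ω = 1}, hA, ?_⟩
  have hall : ∀ᵐ ω ∂ν, ∀ m : ℕ,
      ¬ (ω ∈ E ∧ 1 / ((m : ℝ) + 1) ≤ k ω ∧ k ω ≤ 1 - 1 / ((m : ℝ) + 1)) :=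
    ae_all_iff.2 fun m => by
      rw [ae_iff]
      simpa only [not_not] using hnull m
  filter_upwards [hkE, hall] with ω h1 h2
  by_cases hω : ω ∈ E
  · rw [Set.indicator_of_mem hω, Pi.one_apply] at h1
    by_cases hone : k ω = 1
    · rw [Set.indicator_of_mem (s := {ω | k ω = 1} ∩ E) ⟨hone, hω⟩, hone, Pi.one_apply]
    · rw [Set.indicator_of_notMem fun h => hone h.1]
      by_contra h0
      obtain ⟨m, hm⟩ := exists_nat_one_div_lt
        (lt_min (lt_of_le_of_ne h1.1 (Ne.symm h0)) (sub_pos.2 (lt_of_le_of_ne h1.2 hone)))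
      have := lt_min_iff.1 hm
      exact h2 m ⟨hω, this.1.le, by linarith [this.2]⟩
  · rw [Set.indicator_of_notMem hω] at h1
    rw [Set.indicator_of_notMem fun h => hω h.2]
    exact le_antisymm h1.2 h1.1

/-! ### The range of the vector measure -/

theorem condExpVectorMeasure_apply {Ω : Type*} {𝒞 𝒜 : MeasurableSpace Ω} {n : ℕ} (hm : 𝒞 ≤ 𝒜)
    (μ : Fin n → Measure[𝒜] Ω) (f : (i : Fin n) → Lp ℝ 1 (μ i)) {E : Set Ω}
    (hE : MeasurableSet[𝒜] E) :
    condExpVectorMeasure hm μ f E = fun i => condExpTrim hm (μ i) (E.indicator (f i)) :=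
  if_pos hE

/-- A finite measure with the same null sets as the family `μ`, large enough for every
`h ↦ h f_i` to be bounded from `L²(ν)` to `L¹(μ i)`: the sum of all `(1 + |f_i|) μ i`. -/
theorem exists_dominating_measure {Ω : Type*} [MeasurableSpace Ω] {ι : Type*} [Fintype ι]
    (μ : ι → Measure Ω) [∀ i, IsFiniteMeasure (μ i)] {f : ι → Ω → ℝ}
    (hf : ∀ i, Integrable (f i) (μ i)) :
    ∃ ν : Measure Ω, IsFiniteMeasure ν ∧ (∀ i, μ i ≪ ν) ∧
      (∀ i, (μ i).withDensity (fun ω => ‖f i ω‖ₑ) ≤ ν) ∧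
      ∀ E : Set Ω, (∀ i, μ i E = 0) → ν E = 0 := by
  have hfin : ∀ i, IsFiniteMeasure ((μ i).withDensity fun ω => ‖f i ω‖ₑ) := fun i =>
    isFiniteMeasure_withDensity (hf i).2.ne
  have hle : ∀ i, μ i + (μ i).withDensity (fun ω => ‖f i ω‖ₑ) ≤
      ∑ j, (μ j + (μ j).withDensity fun ω => ‖f j ω‖ₑ) := fun i s => by
    rw [Measure.finsetSum_apply]
    exact Finset.single_le_sum
      (f := fun j => (μ j + (μ j).withDensity fun ω => ‖f j ω‖ₑ) s) (fun _ _ => zero_le)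
      (Finset.mem_univ i)
  refine ⟨∑ i, (μ i + (μ i).withDensity fun ω => ‖f i ω‖ₑ), inferInstance, fun i => ?_,
    fun i => ?_, fun E hE => ?_⟩
  · exact Measure.absolutelyContinuous_of_le ((Measure.le_add_right le_rfl).trans (hle i))
  · exact (Measure.le_add_left le_rfl).trans (hle i)
  · rw [Measure.finsetSum_apply]
    exact Finset.sum_eq_zero fun i _ => by
      rw [Measure.add_apply, hE i, withDensity_absolutelyContinuous _ _ (hE i), add_zero]

theorem theorem2 {Ω : Type*} (𝒞 𝒜 : MeasurableSpace Ω) (h𝒞 : 𝒞 ≤ 𝒜) (n : ℕ)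
    (μ : Fin n → Measure[𝒜] Ω) (hμ : ∀ i, IsFiniteMeasure (μ i))
    (hcoarser : ∀ i, IsCoarser 𝒞 𝒜 (μ i))
    (f : (i : Fin n) → Lp ℝ 1 (μ i)) :
    IsLyapunov (condExpVectorMeasure h𝒞 μ f) := by
  have hf : ∀ i, Integrable (f i) (μ i) := fun i => L1.integrable_coeFn (f i)
  obtain ⟨ν, hν, hμν, hle, hzero⟩ := exists_dominating_measure μ hf
  have hcν : IsCoarser 𝒞 𝒜 ν := .of_forall_absolutelyContinuous hcoarser hμν hzero
  let T : Lp ℝ 2 ν →L[ℝ] ((i : Fin n) → L1Sub h𝒞 (μ i)) :=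
    ContinuousLinearMap.pi fun i => condExpMulCLM h𝒞 (hf i) (hμν i) (hle i)
  have hTi : ∀ {k : Lp ℝ 2 ν} {u : Ω → ℝ}, k =ᵐ[ν] u →
      T k = fun i => condExpTrim h𝒞 (μ i) fun ω => u ω * f i ω := fun hu =>
    funext fun i => condExpMulCLM_eq h𝒞 (hf i) (hμν i) (hle i) hu
  have hTG : ∀ {k : Lp ℝ 2 ν} {B : Set Ω}, MeasurableSet[𝒜] B → k =ᵐ[ν] B.indicator 1 →
      T k = condExpVectorMeasure h𝒞 μ f B := by
    intro k B hB hk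
    rw [hTi hk, condExpVectorMeasure_apply h𝒞 μ f hB]
    refine funext fun i => congrArg _ (funext fun ω => ?_)
    by_cases h : ω ∈ B <;> simp [h]
  have hT : ∀ D : Set Ω, MeasurableSet[𝒜] D → ν D ≠ 0 → ∃ u : Ω → ℝ, Measurable[𝒜] u ∧
      (∀ ω, |u ω| ≤ 1) ∧ (∀ ω ∉ D, u ω = 0) ∧ ν {ω | u ω ≠ 0} ≠ 0 ∧
      ∀ U : Lp ℝ 2 ν, U =ᵐ[ν] u → T U = 0 := by
    intro D hD hD0
    obtain ⟨u, h1, h2, h3, h4, h5⟩ := exists_annihilated h𝒞 hcν hf Finset.univ hD hD0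
    refine ⟨u, h1, h2, h3, h4, fun U hU => ?_⟩
    rw [hTi hU]
    exact funext fun i => condExpTrim_eq_zero h𝒞 (μ i) (h5 i (Finset.mem_univ i))
  intro E hE
  set K : Set (Lp ℝ 2 ν) := Set.Icc 0 (indicatorConstLp 2 hE (measure_ne_top ν E) (1 : ℝ)) with hK
  have hKc : Convex ℝ K := convex_Icc_indicatorConstLp hE
  have hKb : Bornology.IsBounded K := isBounded_Icc_indicatorConstLp hE
  -- The range on `E` already contains all values of `T` on functions between `0` and `χ_E`.
  have hrange : {x | ∃ A : Set Ω, MeasurableSet[𝒜] A ∧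
      condExpVectorMeasure h𝒞 μ f (A ∩ E) = x} = T '' K := by
    ext x
    constructor
    · rintro ⟨A, hA, rfl⟩
      have hind := indicatorConstLp_coeFn (p := 2) (hs := hA.inter hE)
        (hμs := measure_ne_top ν (A ∩ E)) (c := (1 : ℝ))
      refine ⟨_, (mem_Icc_indicatorConstLp hE).2 ?_, hTG (hA.inter hE) hind⟩
      filter_upwards [hind] with ω hω
      rw [hω]
      by_cases h1 : ω ∈ A <;> by_cases h2 : ω ∈ E <;> simp [h1, h2]
    · intro hx
      obtain ⟨k, hk⟩ := extremePoints_fiber_nonempty hKc isClosed_Icc hKb T hx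
      obtain ⟨A, hA, hkA⟩ := exists_indicator_of_mem_extremePoints T hT hE hk
      exact ⟨A, hA, (hTG (hA.inter hE) hkA).symm.trans hk.1.2⟩
  rw [hrange]
  refine ⟨hKc.linear_image T.toLinearMap, ?_⟩
  have hcomp := (isCompact_toWeakSpace_image hKc isClosed_Icc hKb).image
    (WeakSpace.map T).continuous
  rw [Set.image_image] at hcomp ⊢
  exact hcomp
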